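/- Let $\mathbf{K}=(K,\leq_{\mathbf K})$ be an abstract elementary class (AEC) with joint embedding, amalgamation and no maximal models, and let $\operatorname{LS}(\mathbf K)$ be the least cardinal $\chi\ge\aleph_0+|L(\mathbf K)|$ such that for all $N\in\mathbf K$ and $A\subseteq N$ there is $M\leq_{\mathbf K}N$ with $A\subseteq M$ and $\|M\|\le|A|+\chi$. Let $\kappa>\operatorname{LS}(\mathbf K)$ be a cardinal with $\beth_\kappa=\kappa$; sets of cardinality $<\kappa$ are called small. Let $\mathfrak C\in\mathbf K$ be a monster model: every small model in $\mathbf K$ embeds into $\mathfrak C$; if $M\leq_{\mathbf K}N$ are small models and $M\leq_{\mathbf K}\mathfrak C$, then $N$ embeds into $\mathfrak C$ over $M$; and every isomorphism between small $M,M'\leq_{\mathbf K}\mathfrak C$ extends to an automorphism of $\mathfrak C$. In the following $M,N$ denote small models $\leq_{\mathbf K}\mathfrak C$, $A,B$ small subsets of $\mathfrak C$, and sequences are nonempty, small and in $\mathfrak C$. Galois-types are taken in $\mathfrak C$: $\mathbf{tp}(b_1/A)=\mathbf{tp}(b_2/A)$ iff there are $N'\in\mathbf K$ and $\mathbf K$-embeddings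 $f_1,f_2:\mathfrak C\to N'$ that agree on $A$ with $f_1(b_1)=f_2(b_2)$. A simple independence relation in $\mathbf K$ is a relation $A\perp_M B$ between $M$, $A$ and $B$ with the properties below, where $\mathbf{tp}(b/B)$ is said not to fork over $M$ if $\operatorname{ran}(b)\perp_M B$. 1. (Preservation) For $f\in\operatorname{Aut}(\mathfrak C)$: $A\perp_M B$ iff $f[A]\perp_{f[M]}f[B]$. 2. (Monotonicity) If $A\perp_M B$, $A_0\subseteq A$ and $B_0\subseteq B$, then $A_0\perp_M B_0$. 3. (Normality) $A\perp_M B$ iff $A\cup M\perp_M B\cup M$. 4. (Base monotonicity) If $A\perp_M B$, $M\leq_{\mathbf K}N$ and $N\subseteq B$, then $A\perp_N B$. 5. (Existence) If $M\leq_{\mathbf K}N$, every type over $M$ has an extension over $N$ that does not fork over $M$. 6. (Transitivity) If $M\leq_{\mathbf K}N$, $A\perp_M N$ and $A\perp_N B$, then $A\perp_M B$. 7. (Symmetry) $A\perp_M B$ iff $B\perp_M A$. 8. (Type-amalgamation) If $M\subseteq A,B\subseteq N$, $A\perp_M B$, and $q_1,q_2$ are types over $A,B$ respectively (of the same length) that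 do not fork over $M$ and have the same restriction to $M$, then some type over $N$ extends $q_1$ and $q_2$ and does not fork over $M$. 9. (Uniform local character) There are cardinals $\lambda_0,\theta<\kappa$ such that for every type $p$ over $M$ of a sequence of length $\alpha$ there is $M_0\leq_{\mathbf K}M$ with $\|M_0\|\le\lambda_0+|\alpha|^{<\theta}$ such that $p$ does not fork over $M_0$. A family $(\mathbf{tp}(a_i/B_i))_i$ of types of elements is consistent if some $c\in\mathfrak C$ satisfies $\mathbf{tp}(c/B_i)=\mathbf{tp}(a_i/B_i)$ for all $i$. $\mathbf K$ has the $(\mu,\lambda,2)$-tree property if there is a family $\{(a_\eta,B_\eta):\eta\in{}^{<\mu}\lambda\}$ with $a_\eta\in\mathfrak C$ and $B_\eta\subseteq\mathfrak C$ such that - $|B_\eta|<\operatorname{LS}(\mathbf K)$ for all $\eta\in{}^{<\mu}\lambda$; - $\{\mathbf{tp}(a_{\nu\restriction\alpha}/B_{\nu\restriction\alpha}):\alpha<\mu\}$ is consistent for all $\nu\in{}^{\mu}\lambda$; - for all $\eta\in{}^{<\mu}\lambda$ and $\alpha\neq\beta$ in $\lambda$, the types $\mathbf{tp}(a_{\eta^\frown\alpha}/B_{\eta^\frown\alpha})$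 and $\mathbf{tp}(a_{\eta^\frown\beta}/B_{\eta^\frown\beta})$ are not simultaneously realized in $\mathfrak C$. $\mathbf K$ has the 2-tree property if it has the $(\mu,\lambda,2)$-tree property for all small cardinals $\mu,\lambda\ge\operatorname{LS}(\mathbf K)$. **Theorem.** If $\mathbf K$ has a simple independence relation, then $\mathbf K$ does not have the 2-tree property. -/

import Mathlib

open FirstOrder Cardinal

universe u

/-- An abstract elementary class in the vocabulary `L`: a class `mem` of `L`-structures together
with a relation `strong S`, read `S ≤_K N`, between a structure `N` and its substructures `S`. -/
structure AEC (L : FirstOrder.Language.{u, u}) where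
  /-- `N` belongs to the class `K`. -/
  mem : ∀ (N : Type u) [L.Structure N], Prop
  /-- `S ≤_K N`. -/
  strong : ∀ {N : Type u} [L.Structure N], L.Substructure N → Prop
  mem_of_iso : ∀ {M N : Type u} [L.Structure M] [L.Structure N], (M ≃[L] N) → mem M → mem N
  strong_of_iso : ∀ {M N : Type u} [L.Structure M] [L.Structure N] (e : M ≃[L] N)
    (S : L.Substructure M), strong S → strong (S.map e.toHom)
  /-- `≤_K` is a relation between members of `K`. -/
  mem_of_strong : ∀ {N : Type u} [L.Structure N] (S : L.Substructure N),
    strong S → mem S ∧ mem N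
  refl : ∀ {N : Type u} [L.Structure N], mem N → strong (⊤ : L.Substructure N)
  trans : ∀ {N : Type u} [L.Structure N] (T : L.Substructure N) (S : L.Substructure T),
    strong T → strong S → strong (S.map T.subtype.toHom)
  /-- Coherence: if `S ⊆ T`, `S ≤_K N` and `T ≤_K N`, then `S ≤_K T`. -/
  coherence : ∀ {N : Type u} [L.Structure N] (S T : L.Substructure N),
    S ≤ T → strong S → strong T → strong (S.comap T.subtype.toHom)
  /-- The union `N` of a nonempty `≤_K`-chain `c` is in `K`, and `S ≤_K N` for each `S` in `c`. -/
  chain_union : ∀ {N : Type u} [L.Structure N] (c : Set (L.Substructure N)),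
    c.Nonempty → IsChain (· ≤ ·) c → (∀ S ∈ c, mem S) →
    (∀ S ∈ c, ∀ T ∈ c, S ≤ T → strong (S.comap T.subtype.toHom)) →
    sSup c = ⊤ → mem N ∧ ∀ S ∈ c, strong S
  /-- Smoothness: if all members of a nonempty chain are `≤_K N`, then so is their union. -/
  chain_smooth : ∀ {N : Type u} [L.Structure N] (c : Set (L.Substructure N)),
    c.Nonempty → IsChain (· ≤ ·) c → (∀ S ∈ c, strong S) → strong (sSup c)
  /-- Downward Löwenheim–Skolem axiom. -/
  exists_LS : ∃ χ : Cardinal.{u}, ℵ₀ ≤ χ ∧ L.card ≤ χ ∧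
    ∀ {N : Type u} [L.Structure N], mem N → ∀ A : Set N,
      ∃ S : L.Substructure N, strong S ∧ A ⊆ S ∧ #S ≤ #A + χ

namespace AEC

variable {L : FirstOrder.Language.{u, u}} (K : AEC L)

/-- The Löwenheim–Skolem number `LS(K)`: the least cardinal `χ ≥ ℵ₀ + |L|` as in the downward
Löwenheim–Skolem axiom. -/
noncomputable def LS : Cardinal.{u} :=
  sInf {χ : Cardinal.{u} | ℵ₀ ≤ χ ∧ L.card ≤ χ ∧
    ∀ {N : Type u} [L.Structure N], K.mem N → ∀ A : Set N,
      ∃ S : L.Substructure N, K.strong S ∧ A ⊆ S ∧ #S ≤ #A + χ}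

/-- `f : M → N` is a `K`-embedding: `f : M ≅ f[M]` and `f[M] ≤_K N`. -/
def IsEmb {M N : Type u} [L.Structure M] [L.Structure N] (f : M ↪[L] N) : Prop :=
  K.strong f.toHom.range

def JointEmbedding : Prop :=
  ∀ (M N : Type u) [L.Structure M] [L.Structure N], K.mem M → K.mem N →
    ∃ (P : Type u) (_ : L.Structure P) (f : M ↪[L] P) (g : N ↪[L] P),
      K.mem P ∧ K.IsEmb f ∧ K.IsEmb g

def Amalgamation : Prop :=
  ∀ (M₀ M₁ M₂ : Type u) [L.Structure M₀] [L.Structure M₁] [L.Structure M₂]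
    (f₁ : M₀ ↪[L] M₁) (f₂ : M₀ ↪[L] M₂), K.IsEmb f₁ → K.IsEmb f₂ →
    ∃ (N : Type u) (_ : L.Structure N) (g₁ : M₁ ↪[L] N) (g₂ : M₂ ↪[L] N),
      K.mem N ∧ K.IsEmb g₁ ∧ K.IsEmb g₂ ∧ ∀ x, g₁ (f₁ x) = g₂ (f₂ x)

def NoMaximalModels : Prop :=
  ∀ (M : Type u) [L.Structure M], K.mem M →
    ∃ (N : Type u) (_ : L.Structure N) (f : M ↪[L] N),
      K.mem N ∧ K.IsEmb f ∧ ¬ Function.Surjective f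

/-- `C` is a monster model of `K` with respect to the cardinal `κ` (sets of cardinality `< κ` are
the small ones): it is universal, model homogeneous and strongly homogeneous for small models. -/
structure IsMonster (κ : Cardinal.{u}) (C : Type u) [L.Structure C] : Prop where
  mem : K.mem C
  universal : ∀ (N : Type u) [L.Structure N], K.mem N → #N < κ →
    ∃ f : N ↪[L] C, K.IsEmb f
  modelHomogeneous : ∀ (N : Type u) [L.Structure N], K.mem N → #N < κ →
    ∀ M : L.Substructure N, K.strong M → ∀ g : M ↪[L] C, K.IsEmb g →
      ∃ f : N ↪[L] C, K.IsEmb f ∧ ∀ x : M, f x = g x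
  stronglyHomogeneous : ∀ M M' : L.Substructure C, K.strong M → K.strong M' → #M < κ →
    ∀ e : M ≃[L] M', ∃ f : C ≃[L] C, ∀ x : M, f x = e x

section Monster

variable {C : Type u} [L.Structure C]

/-- `tp(b₁ / A; C) = tp(b₂ / A; C)`, the equality of Galois-types: there are `N ∈ K` and
`K`-embeddings `f₁, f₂ : C → N` that agree on `A` and satisfy `f₁(b₁) = f₂(b₂)`. -/
def TpEq {I : Type*} (A : Set C) (b₁ b₂ : I → C) : Prop :=
  ∃ (N : Type u) (_ : L.Structure N) (f₁ f₂ : C ↪[L] N),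
    K.mem N ∧ K.IsEmb f₁ ∧ K.IsEmb f₂ ∧ (∀ x ∈ A, f₁ x = f₂ x) ∧ ∀ i, f₁ (b₁ i) = f₂ (b₂ i)

/-- `Ind M A B` is an independence relation in `K` (inside the monster model `C`). The type
`tp(b / B)` of a sequence `b` does not fork over `M` if `Ind M (Set.range b) B`. All models, sets
and sequences are small. -/
structure IsIndependence (κ : Cardinal.{u})
    (Ind : L.Substructure C → Set C → Set C → Prop) : Prop where
  base_strong : ∀ M A B, Ind M A B → K.strong M
  /-- Preservation under `K`-embeddings. -/
  preservation : ∀ (M : L.Substructure C) (A B : Set C) (f : C ≃[L] C),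
    K.strong M → #M < κ → #A < κ → #B < κ →
    (Ind M A B ↔ Ind (M.map f.toHom) (f '' A) (f '' B))
  monotonicity : ∀ (M : L.Substructure C) (A B A₀ B₀ : Set C),
    K.strong M → #M < κ → #A < κ → #B < κ →
    Ind M A B → A₀ ⊆ A → B₀ ⊆ B → Ind M A₀ B₀
  normality : ∀ (M : L.Substructure C) (A B : Set C),
    K.strong M → #M < κ → #A < κ → #B < κ →
    (Ind M A B ↔ Ind M (A ∪ M) (B ∪ M))
  baseMonotonicity : ∀ (M N : L.Substructure C) (A B : Set C),
    K.strong M → K.strong N → #M < κ → #N < κ → #A < κ → #B < κ →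
    Ind M A B → M ≤ N → (N : Set C) ⊆ B → Ind N A B
  existence : ∀ (M N : L.Substructure C), K.strong M → K.strong N → #M < κ → #N < κ → M ≤ N →
    ∀ (I : Type u) [Nonempty I], #I < κ → ∀ b : I → C,
      ∃ b' : I → C, K.TpEq (M : Set C) b' b ∧ Ind M (Set.range b') N
  transitivity : ∀ (M N : L.Substructure C) (A B : Set C),
    K.strong M → K.strong N → #M < κ → #N < κ → #A < κ → #B < κ →
    M ≤ N → Ind M A N → Ind N A B → Ind M A B

/-- `Ind` is a simple independence relation in `K`. -/
structure IsSimpleIndependence (κ : Cardinal.{u})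
    (Ind : L.Substructure C → Set C → Set C → Prop) : Prop extends
    K.IsIndependence κ Ind where
  symmetry : ∀ (M : L.Substructure C) (A B : Set C),
    K.strong M → #M < κ → #A < κ → #B < κ → (Ind M A B ↔ Ind M B A)
  /-- Here `p = tp(b₁/M) = tp(b₂/M)`, `q₁ = tp(b₁/A)`, `q₂ = tp(b₂/B)` and `q = tp(b/N)`. -/
  typeAmalgamation : ∀ (M N : L.Substructure C) (A B : Set C),
    K.strong M → K.strong N → #M < κ → #N < κ →
    (M : Set C) ⊆ A → (M : Set C) ⊆ B → A ⊆ N → B ⊆ N → Ind M A B →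
    ∀ (I : Type u) [Nonempty I], #I < κ → ∀ b₁ b₂ : I → C,
      K.TpEq (M : Set C) b₁ b₂ → Ind M (Set.range b₁) A → Ind M (Set.range b₂) B →
      ∃ b : I → C, K.TpEq A b b₁ ∧ K.TpEq B b b₂ ∧ Ind M (Set.range b) N
  uniformLocalCharacter : ∃ lam θ : Cardinal.{u}, lam < κ ∧ θ < κ ∧
    ∀ M : L.Substructure C, K.strong M → #M < κ →
    ∀ (I : Type u) [Nonempty I], #I < κ → ∀ b : I → C,
      ∃ M₀ : L.Substructure C, K.strong M₀ ∧ M₀ ≤ M ∧ #M₀ ≤ lam + (#I ^< θ) ∧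
        Ind M₀ (Set.range b) M

/-- The family of Galois-types `tp(a i / B i)`, `i ∈ s`, of elements is consistent: some element
of `C` realizes all of them. -/
def Consistent {ι : Type*} (s : Set ι) (a : ι → C) (B : ι → Set C) : Prop :=
  ∃ c : C, ∀ i ∈ s, K.TpEq (B i) (fun _ : Unit => c) (fun _ => a i)

/-- The family of Galois-types `tp(a i / B i)` is `k`-contradictory: for any `k` distinct indices
the corresponding types are inconsistent. -/
def Contradictory (k : ℕ) {ι : Type*} (a : ι → C) (B : ι → Set C) : Prop :=
  ∀ s : Finset ι, s.card = k → ¬ K.Consistent (s : Set ι) a B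

end Monster

/-- The concatenation `η⌢β` of a sequence `η` of length `α` with one further term `β`. -/
noncomputable def snoc {X : Type*} {α : Ordinal.{u}} (η : Set.Iio α → X) (β : X) :
    Set.Iio (Order.succ α) → X := by
  classical
  exact fun i => if h : i.1 < α then η ⟨i.1, h⟩ else β

/-- The restriction of `ν` to an ordinal `α < μ`. -/
def res {X : Type*} {μ : Ordinal.{u}} (ν : Set.Iio μ → X) (α : Set.Iio μ) : Set.Iio α.1 → X :=
  fun i => ν ⟨i.1, lt_trans (Set.mem_Iio.1 i.2) (Set.mem_Iio.1 α.2)⟩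

/-- `K` has the `(μ, lam, k)`-tree property (inside `C`). A node `η` of the tree is a sequence of
ordinals below `lam` whose length `α` is an ordinal below `μ`; only the values of `a` and `B` at
such `α` matter. -/
def TreePropertyAt (C : Type u) [L.Structure C] (μ lam : Cardinal.{u}) (k : ℕ) : Prop :=
  ∃ (a : ∀ α : Ordinal.{u}, (Set.Iio α → Set.Iio lam.ord) → C)
    (B : ∀ α : Ordinal.{u}, (Set.Iio α → Set.Iio lam.ord) → Set C),
    (∀ α < μ.ord, ∀ η : Set.Iio α → Set.Iio lam.ord, #(B α η) < K.LS) ∧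
    (∀ ν : Set.Iio μ.ord → Set.Iio lam.ord,
      K.Consistent Set.univ (fun α : Set.Iio μ.ord => a α (res ν α)) (fun α => B α (res ν α))) ∧
    (∀ α < μ.ord, ∀ η : Set.Iio α → Set.Iio lam.ord,
      K.Contradictory k (fun β => a (Order.succ α) (snoc η β))
        (fun β => B (Order.succ α) (snoc η β)))

/-- `K` has the `k`-tree property: the `(μ, lam, k)`-tree property holds for all (small) cardinals
`μ, lam ≥ LS(K)`. -/
def TreeProperty (κ : Cardinal.{u}) (C : Type u) [L.Structure C] (k : ℕ) : Prop :=
  ∀ μ lam : Cardinal.{u}, K.LS ≤ μ → μ < κ → K.LS ≤ lam → lam < κ → K.TreePropertyAt C μ lam k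

end AEC

/-! Along a suitable branch of the tree, two siblings are conjugate and independent over a model
that can serve as a non-forking base, so type-amalgamation realizes both, against
2-contradictoriness. Let `lam₀`, `θ` witness local character. Choose a regular `μ > LS + lam₀`, then
`χ ≥ μ` bounding the bases of types of at most `LS` elements, and more than `2 ^ χ` children per
node. Siblings (`exists_conj_independent`): there are at most `2 ^ χ` conjugacy classes over a set
of size `χ`, because each pair `(a, B)` is coded by a small model. Hence some model `U` of size at
most `2 ^ χ` contains, for every child `i` and every `s ⊆ U` of size at most `χ`, the set `B j` of a
child `j` conjugate to `i` over `s`, with `j` drawn from a set `W` of at most `2 ^ χ` children. For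
`i` outside `W`, a base of the type of `(a i, B i)` over `U` extends to `N ⊆ U` of size at most `χ`;
a `j ∈ W` conjugate to `i` over `N` is then independent from `i` over `N`. Iterating `μ` times
(`exists_independent_branch`) gives a branch and an increasing chain of models absorbing its sets
`B`. If `c` realizes the branch, its type over the union of the chain does not fork over a model of
size `< μ`, which by regularity lies in some `N i`. So the type of `c` over the next `B` does not
fork over `N i`, and `exists_realize_conj` amalgamates it with its conjugate at the sibling. -/

namespace AEC

variable {L : FirstOrder.Language.{u, u}} {K : AEC L}

/-! ### `K`-embeddings and the Löwenheim–Skolem number -/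

section Embeddings

theorem isEmb_of_equiv {M : Type u} [L.Structure M] {N : Type u} [L.Structure N]
    (e : M ≃[L] N) (hM : K.mem M) : K.IsEmb e.toEmbedding := by
  have hN := K.refl (K.mem_of_iso e hM)
  have : e.toEmbedding.toHom.range = ⊤ := by
    apply SetLike.coe_injective
    ext x
    simpa using e.surjective x
  unfold IsEmb
  rwa [this]

theorem isEmb_refl {M : Type u} [L.Structure M] (hM : K.mem M) :
    K.IsEmb (Language.Embedding.refl L M) :=
  isEmb_of_equiv (Language.Equiv.refl L M) hM

theorem isEmb_subtype {N : Type u} [L.Structure N] (S : L.Substructure N) (hS : K.strong S) :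
    K.IsEmb S.subtype := by
  unfold IsEmb
  rwa [Language.Substructure.range_subtype]

/-- The image of a strong substructure under a `K`-embedding is strong. -/
theorem IsEmb.strong_map {M N : Type u} [L.Structure M] [L.Structure N] {f : M ↪[L] N}
    (hf : K.IsEmb f) (S : L.Substructure M) (hS : K.strong S) : K.strong (S.map f.toHom) := by
  have h1 := K.strong_of_iso f.equivRange S hS
  have h2 := K.trans _ _ hf h1
  convert h2 using 1
  apply SetLike.coe_injective
  ext x
  simp only [Language.Substructure.coe_map, Set.mem_image]
  constructor
  · rintro ⟨y, hy, rfl⟩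
    exact ⟨f.equivRange y, ⟨y, hy, rfl⟩, rfl⟩
  · rintro ⟨_, ⟨y, hy, rfl⟩, rfl⟩
    exact ⟨y, hy, rfl⟩

theorem IsEmb.comp {M N P : Type u} [L.Structure M] [L.Structure N] [L.Structure P]
    {g : N ↪[L] P} {f : M ↪[L] N} (hg : K.IsEmb g) (hf : K.IsEmb f) : K.IsEmb (g.comp f) := by
  have h := hg.strong_map _ hf
  unfold IsEmb
  convert h using 1
  apply SetLike.coe_injective
  ext x
  simp

/-- The Löwenheim–Skolem property inside a strong substructure `T`. -/
theorem exists_strong_between {N : Type u} [L.Structure N] (T : L.Substructure N)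
    (hT : K.strong T) (A : Set N) (hA : A ⊆ T) :
    ∃ S : L.Substructure N, K.strong S ∧ S ≤ T ∧ A ⊆ S ∧ #S ≤ #A + K.LS := by
  have hLS := csInf_mem (s := {χ : Cardinal.{u} | ℵ₀ ≤ χ ∧ L.card ≤ χ ∧
    ∀ {N : Type u} [L.Structure N], K.mem N → ∀ A : Set N,
      ∃ S : L.Substructure N, K.strong S ∧ A ⊆ S ∧ #S ≤ #A + χ}) K.exists_LS
  -- The infimum defining `LS` is attained, so the property applies inside `T` regarded as a model;
  -- the result is pushed back to `N`.
  obtain ⟨S, hS, hAS, hc⟩ := hLS.2.2 (K.mem_of_strong T hT).1 ((↑) ⁻¹' A : Set T)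
  refine ⟨S.map T.subtype.toHom, K.trans T S hT hS, ?_, ?_, ?_⟩
  · rintro _ ⟨y, -, rfl⟩
    exact y.2
  · intro x hx
    exact ⟨⟨x, hA hx⟩, hAS hx, rfl⟩
  · have h1 : #(S.map T.subtype.toHom) ≤ #S := by
      have := mk_image_le (f := T.subtype.toHom) (s := (S : Set T))
      exact this
    refine h1.trans (hc.trans ?_)
    refine add_le_add_left ?_ _
    exact mk_preimage_of_injective _ _ Subtype.val_injective

theorem exists_strong_superset {N : Type u} [L.Structure N] (hN : K.mem N) (A : Set N) :
    ∃ S : L.Substructure N, K.strong S ∧ A ⊆ S ∧ #S ≤ #A + K.LS := by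
  obtain ⟨S, h1, -, h2, h3⟩ := exists_strong_between ⊤ (K.refl hN) A (by simp)
  exact ⟨S, h1, h2, h3⟩

theorem aleph0_le_LS : ℵ₀ ≤ K.LS := (csInf_mem K.exists_LS).1

theorem card_le_LS : L.card ≤ K.LS := (csInf_mem K.exists_LS).2.1

end Embeddings

/-! ### Galois-types -/

section Types

variable {C : Type u} [L.Structure C] {I : Type*}

theorem TpEq.mono {A B : Set C} {b₁ b₂ : I → C} (h : K.TpEq A b₁ b₂) (hB : B ⊆ A) :
    K.TpEq B b₁ b₂ := by
  obtain ⟨N, _, f₁, f₂, h1, h2, h3, h4, h5⟩ := h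
  exact ⟨N, _, f₁, f₂, h1, h2, h3, fun x hx => h4 x (hB hx), h5⟩

/-- The two witnessing models are amalgamated over the copies of `C` on which `b₂` is evaluated. -/
theorem TpEq.trans (hAP : K.Amalgamation) {A : Set C} {b₁ b₂ b₃ : I → C} (h : K.TpEq A b₁ b₂)
    (h' : K.TpEq A b₂ b₃) : K.TpEq A b₁ b₃ := by
  obtain ⟨N, _, f₁, f₂, h1, h2, h3, h4, h5⟩ := h
  obtain ⟨N', _, f₁', f₂', h1', h2', h3', h4', h5'⟩ := h'
  obtain ⟨P, _, g₁, g₂, hP, hg1, hg2, hg⟩ := hAP C N N' f₂ f₁' h3 h2'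
  refine ⟨P, _, g₁.comp f₁, g₂.comp f₂', hP, hg1.comp h2, hg2.comp h3', ?_, ?_⟩
  · intro x hx
    simp [h4 x hx, hg, h4' x hx]
  · intro i
    simp [h5 i, hg, h5' i]

theorem tpEq_of_aut (hC : K.mem C) {A : Set C} (f : C ≃[L] C) (hf : ∀ x ∈ A, f x = x)
    (b : I → C) : K.TpEq A b (fun i => f (b i)) :=
  ⟨C, _, f.toEmbedding, Language.Embedding.refl L C, hC, isEmb_of_equiv f hC,
    isEmb_refl hC, fun x hx => hf x hx, fun _ => rfl⟩

theorem TpEq.map (hC : K.mem C) {A : Set C} {b₁ b₂ : I → C} (h : K.TpEq A b₁ b₂)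
    (f : C ≃[L] C) : K.TpEq (f '' A) (fun i => f (b₁ i)) (fun i => f (b₂ i)) := by
  obtain ⟨N, _, f₁, f₂, h1, h2, h3, h4, h5⟩ := h
  have hf := isEmb_of_equiv f.symm hC
  refine ⟨N, _, f₁.comp f.symm.toEmbedding, f₂.comp f.symm.toEmbedding, h1, h2.comp hf,
    h3.comp hf, ?_, ?_⟩
  · rintro _ ⟨x, hx, rfl⟩
    simpa using h4 x hx
  · intro i
    simpa using h5 i

end Types

/-! ### Coding a pair `(a, B)` over `M` by a small structure -/

section Conj

variable {C : Type u} [L.Structure C]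

/-- Some automorphism over `M` maps the element `a` to `a'` and the set `B` to `B'`. -/
def ConjOver (L : FirstOrder.Language.{u, u}) {C : Type u} [L.Structure C] (M : Set C)
    (a : C) (B : Set C) (a' : C) (B' : Set C) : Prop :=
  ∃ f : C ≃[L] C, (∀ x ∈ M, f x = x) ∧ f a = a' ∧ f '' B = B'

/-- `(a, B)` is the image of `(s, T)` under a strong embedding of `S` that maps `m` to the
identity of `M`. -/
def IsCopy (K : AEC L) {M : Set C} {S : Type u} (str : L.Structure S) (m : M → S) (s : S)
    (T : Set S) (a : C) (B : Set C) : Prop :=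
  ∃ g : S ↪[L] C, K.IsEmb g ∧ (∀ x, g (m x) = x) ∧ g s = a ∧ g '' T = B

/-- Both pairs sit in strong images of the same `S`; strong homogeneity extends the isomorphism
between these images. -/
theorem IsMonster.conjOver_of_isCopy {κ : Cardinal.{u}} (hC : K.IsMonster κ C) {M : Set C}
    {S : Type u} (str : L.Structure S) {m : M → S} {s : S} {T : Set S} (hS : #S < κ)
    {a a' : C} {B B' : Set C} (h : K.IsCopy str m s T a B) (h' : K.IsCopy str m s T a' B') :
    ConjOver L M a B a' B' := by
  obtain ⟨g, hg, hgm, rfl, rfl⟩ := h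
  obtain ⟨g', hg', hgm', rfl, rfl⟩ := h'
  have hcard : #g.toHom.range < κ := by
    refine lt_of_le_of_lt ?_ hS
    have := mk_range_le (f := g)
    exact this
  obtain ⟨f, hf⟩ := hC.stronglyHomogeneous _ _ hg hg' hcard
    (g'.equivRange.comp g.equivRange.symm)
  have key : ∀ x : S, f (g x) = g' x := by
    intro x
    have := hf (g.equivRange x)
    simpa using this
  refine ⟨f, ?_, key s, ?_⟩
  · intro x hx
    have := key (m ⟨x, hx⟩)
    rwa [hgm, hgm'] at this
  · rw [← Set.image_comp]
    exact Set.image_congr fun x _ => key x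

/-- A strong model around `a`, `M` and `B` is transported to a subset of the fixed set `X`, so that
all codes range over one set. -/
theorem exists_isCopy (hC : K.mem C) {X : Type u} (hX : K.LS ≤ #X) {M : Set C} (hM : #M ≤ #X)
    (a : C) {B : Set C} (hB : #B ≤ #X) :
    ∃ (S : Set X) (str : L.Structure S) (m : M → S) (s : S) (T : Set S),
      K.IsCopy str m s T a B := by
  have hX0 : ℵ₀ ≤ #X := aleph0_le_LS.trans hX
  obtain ⟨N, hN, hsub, hcard⟩ := exists_strong_superset hC (insert a (M ∪ B))
  have hN' : #N ≤ #X := by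
    refine hcard.trans (add_le_of_le hX0 ?_ hX)
    refine mk_insert_le.trans (add_le_of_le hX0 ?_ (one_le_aleph0.trans hX0))
    exact (mk_union_le _ _).trans (add_le_of_le hX0 hM hB)
  obtain ⟨i⟩ := hN'
  let e : N ≃ Set.range i := Equiv.ofInjective i i.injective
  let str : L.Structure (Set.range i) := e.inducedStructure
  let E : N ≃[L] Set.range i := e.inducedStructureEquiv
  refine ⟨Set.range i, str, fun x => E ⟨x, hsub (by simp [x.2])⟩, E ⟨a, hsub (by simp)⟩,
    {y | (E.symm y : C) ∈ B}, N.subtype.comp E.symm.toEmbedding,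
    (isEmb_subtype N hN).comp (isEmb_of_equiv _ ?_), ?_, ?_, ?_⟩
  · exact K.mem_of_iso E (K.mem_of_strong N hN).1
  · intro x
    simp
  · simp
  · ext x
    simp only [Set.mem_image, Set.mem_ofPred_eq]
    constructor
    · rintro ⟨y, hy, rfl⟩
      exact hy
    · intro hx
      exact ⟨E ⟨x, hsub (by simp [hx])⟩, by simpa using hx, by simp⟩

end Conj

/-! ### Counting conjugacy classes -/

section Counting

theorem mk_structure_le {S : Type u} {χ : Cardinal.{u}} (hχ : ℵ₀ ≤ χ) (hL : L.card ≤ χ)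
    (hS : #S ≤ χ) : #(L.Structure S) ≤ 2 ^ χ := by
  have hlist : #(List S) ≤ χ := (mk_list_le_max S).trans (max_le hχ hS)
  -- A structure is coded by the graphs of its functions and its true atomic relations; writing
  -- tuples as lists puts all arities in one type.
  let F := Set ((L.Symbols × List S) × S) × Set (L.Symbols × List S)
  let φ : L.Structure S → F := fun str =>
    (Set.range fun p : (Σ n, L.Functions n × (Fin n → S)) =>
      ((Sum.inl ⟨p.1, p.2.1⟩, List.ofFn p.2.2), str.funMap p.2.1 p.2.2),
     {q | ∃ (n : ℕ) (r : L.Relations n) (x : Fin n → S), str.RelMap r x ∧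
      q = (Sum.inr ⟨n, r⟩, List.ofFn x)})
  have hφ : Function.Injective φ := by
    intro s t hst
    rw [Prod.ext_iff] at hst
    obtain ⟨h1, h2⟩ := hst
    have hr : ∀ (s t : L.Structure S), (φ s).2 = (φ t).2 → ∀ n (r : L.Relations n) x,
        s.RelMap r x → t.RelMap r x := by
      intro s t h n r x hx
      have : ((Sum.inr ⟨n, r⟩, List.ofFn x) : L.Symbols × List S) ∈ (φ s).2 :=
        ⟨n, r, x, hx, rfl⟩
      rw [h] at this
      obtain ⟨n', r', x', hx', he⟩ := this
      simp only [Prod.mk.injEq, Sum.inr.injEq, Sigma.mk.injEq] at he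
      obtain ⟨⟨rfl, hrr⟩, hxx⟩ := he
      rw [List.ofFn_injective hxx, eq_of_heq hrr]
      exact hx'
    ext n f x
    · have : ((Sum.inl ⟨n, f⟩, List.ofFn x), s.funMap f x) ∈ (φ s).1 :=
        ⟨⟨n, f, x⟩, rfl⟩
      rw [h1] at this
      obtain ⟨⟨n', f', x'⟩, he⟩ := this
      simp only [Prod.mk.injEq, Sum.inl.injEq, Sigma.mk.injEq] at he
      obtain ⟨⟨⟨rfl, hff⟩, hxx⟩, hv⟩ := he
      rw [← List.ofFn_injective hxx, ← eq_of_heq hff]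
      rw [← List.ofFn_injective hxx, ← eq_of_heq hff] at hv
      exact hv.symm
    · exact ⟨hr s t h2 n f x, hr t s h2.symm n f x⟩
  refine (mk_le_of_injective hφ).trans ?_
  have h2χ : ℵ₀ ≤ (2 : Cardinal.{u}) ^ χ := hχ.trans (cantor χ).le
  have hsym : #L.Symbols ≤ χ := hL
  simp only [F, mk_prod, mk_set, lift_id]
  have hp : #L.Symbols * #(List S) ≤ χ := mul_le_of_le hχ hsym hlist
  refine mul_le_of_le h2χ ?_ ?_
  · exact power_le_power_left two_ne_zero (mul_le_of_le hχ hp hS)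
  · exact power_le_power_left two_ne_zero hp

/-- At most `2 ^ #X` conjugacy classes over a set of size at most `#X`. -/
theorem IsMonster.exists_conj_representatives {κ : Cardinal.{u}} {C : Type u} [L.Structure C]
    (hC : K.IsMonster κ C) {χ : Cardinal.{u}} (hχ : K.LS ≤ χ) (hχκ : χ < κ)
    {M : Set C} (hM : #M ≤ χ) {ι : Type u} (a : ι → C) (B : ι → Set C) (hB : ∀ i, #(B i) ≤ χ) :
    ∃ W : Set ι, #W ≤ 2 ^ χ ∧ ∀ i, ∃ j ∈ W, ConjOver L M (a i) (B i) (a j) (B j) := by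
  induction χ using Cardinal.inductionOn with
  | _ X =>
  have hX0 : ℵ₀ ≤ #X := aleph0_le_LS.trans hχ
  have h2X : ℵ₀ ≤ (2 : Cardinal.{u}) ^ #X := hX0.trans (cantor _).le
  choose S str m s T hcopy using fun i => exists_isCopy hC.mem hχ hM (a i) (hB i)
  let Code := Σ S : Set X, L.Structure S × (M → S) × S × Set S
  let k : ι → Code := fun i => ⟨S i, str i, m i, s i, T i⟩
  have hcode : #Code ≤ 2 ^ #X := by
    rw [mk_sigma]
    refine (sum_le_mk_mul_iSup _).trans ?_
    refine mul_le_of_le h2X (by simp) (ciSup_le' fun S => ?_)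
    have hS : #S ≤ #X := mk_set_le S
    simp only [mk_prod, mk_set, lift_id, mk_pi, prod_const]
    refine mul_le_of_le h2X (mk_structure_le hX0 (card_le_LS.trans hχ) hS)
      (mul_le_of_le h2X ?_ (mul_le_of_le h2X (hS.trans (cantor _).le) ?_))
    · calc #S ^ #M ≤ (2 ^ #X) ^ #X :=
            (power_le_power_right (hS.trans (cantor _).le)).trans
              (power_le_power_left (power_ne_zero _ two_ne_zero) hM)
        _ = 2 ^ #X := by rw [← power_mul, mul_eq_self hX0]
    · exact power_le_power_left two_ne_zero hS
  -- One index is chosen for each code that occurs.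
  refine ⟨Set.range fun y : Set.range k => y.2.choose, ?_, ?_⟩
  · exact mk_range_le.trans ((mk_set_le _).trans hcode)
  · intro i
    have hk : k (⟨i, rfl⟩ : k i ∈ Set.range k).choose = k i :=
      (⟨i, rfl⟩ : k i ∈ Set.range k).choose_spec
    refine ⟨_, ⟨⟨k i, i, rfl⟩, rfl⟩, ?_⟩
    set j := (⟨i, rfl⟩ : k i ∈ Set.range k).choose
    -- As a predicate of the whole dependent tuple, `Q` allows rewriting along the equality of
    -- codes.
    let Q : Code → C → Set C → Prop := fun c => K.IsCopy c.2.1 c.2.2.1 c.2.2.2.1 c.2.2.2.2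
    have hi : Q (k i) (a i) (B i) := hcopy i
    have hj : Q (k j) (a j) (B j) := hcopy j
    rw [hk] at hj
    exact hC.conjOver_of_isCopy _ ((mk_set_le _).trans_lt hχκ) hi hj

end Counting

end AEC

/-! ### Transfinite chains and conjugate independent pairs -/

namespace AEC

/-- Recursion with choice. `P` must be satisfiable after every history, so it is later applied to
implications that junk values satisfy when the history is bad. -/
theorem exists_transfinite {X : Type*} (P : (i : Ordinal.{u}) → (Set.Iio i → X) → X → Prop)
    (h : ∀ i g, ∃ x, P i g x) : ∃ F : Ordinal.{u} → X, ∀ i, P i (fun j => F j) (F i) := by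
  choose f hf using h
  let F : Ordinal.{u} → X := Ordinal.lt_wf.fix fun i rec => f i fun j => rec j.1 j.2
  refine ⟨F, fun i => ?_⟩
  have : F i = f i fun j => F j := Ordinal.lt_wf.fix_eq _ i
  rw [this]
  exact hf _ _

theorem mk_iUnion_Iio_le {β : Type u} {o : Ordinal.{u}} {c : Cardinal.{u}} (ho : o.card ≤ c)
    (hc : ℵ₀ ≤ c) (f : Set.Iio o → Set β) (hf : ∀ j, #(f j) ≤ c) : #(⋃ j, f j) ≤ c := by
  -- `Set.Iio o` lives one universe too high for the cardinal bound, hence the reindexing by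
  -- `o.ToType`.
  have : ⋃ j, f j = ⋃ t : o.ToType, f t.toOrd :=
    (Ordinal.ToType.mk.symm.surjective.iUnion_comp f).symm
  rw [this]
  refine (mk_iUnion_le _).trans (mul_le_of_le hc ?_ (ciSup_le' fun t => hf _))
  rwa [mk_toType]

theorem mk_biUnion_le_of_forall {ι α : Type u} {c : Cardinal.{u}} (hc : ℵ₀ ≤ c) (W : Set ι)
    (hW : #W ≤ c) (B : ι → Set α) (hB : ∀ i, #(B i) ≤ c) : #(⋃ i ∈ W, B i : Set α) ≤ c :=
  (mk_biUnion_le _ _).trans (mul_le_of_le hc hW (ciSup_le' fun i => hB i))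

/-- A small subset of the union of an increasing chain of regular length lies in some member. -/
theorem exists_subset_of_subset_iUnion {α : Type u} {ρ : Cardinal.{u}} (hρ : ρ.IsRegular)
    (N : Ordinal.{u} → Set α) (hmono : ∀ i < ρ.ord, ∀ j < i, N j ⊆ N i) {s : Set α}
    (hs : #s < ρ) (hsub : s ⊆ ⋃ i : Set.Iio ρ.ord, N i) : ∃ i < ρ.ord, s ⊆ N i := by
  have : ∀ x : s, ∃ i < ρ.ord, x.1 ∈ N i := by
    intro x
    obtain ⟨i, hi⟩ := Set.mem_iUnion.1 (hsub x.2)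
    exact ⟨i, i.2, hi⟩
  choose g hg hxg using this
  have hsup : ⨆ x, g x < ρ.ord := Ordinal.iSup_lt_of_lt_cof (by rwa [hρ.cof_ord]) hg
  refine ⟨_, hsup, fun x hx => ?_⟩
  have hle : g ⟨x, hx⟩ ≤ ⨆ x, g x := Ordinal.le_iSup g ⟨x, hx⟩
  rcases hle.lt_or_eq with h | h
  · exact hmono _ hsup _ h (hxg ⟨x, hx⟩)
  · rw [← h]
    exact hxg ⟨x, hx⟩

variable {L : FirstOrder.Language.{u, u}} {K : AEC L} {C : Type u} [L.Structure C]

theorem exists_strong_iUnion {o : Ordinal.{u}} (ho : 0 < o) (N : Ordinal.{u} → L.Substructure C)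
    (hN : ∀ i < o, K.strong (N i)) (hmono : ∀ i < o, ∀ j < i, N j ≤ N i) :
    ∃ U : L.Substructure C, K.strong U ∧ (U : Set C) = ⋃ i : Set.Iio o, (N i : Set C) := by
  let c : Set (L.Substructure C) := N '' Set.Iio o
  have hne : c.Nonempty := ⟨_, 0, ho, rfl⟩
  have hchain : IsChain (· ≤ ·) c := by
    rintro _ ⟨i, hi, rfl⟩ _ ⟨j, hj, rfl⟩ -
    rcases lt_trichotomy i j with h | rfl | h
    · exact Or.inl (hmono j hj i h)
    · exact Or.inl le_rfl
    · exact Or.inr (hmono i hi j h)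
  refine ⟨sSup c, K.chain_smooth c hne hchain ?_, ?_⟩
  · rintro _ ⟨i, hi, rfl⟩
    exact hN i hi
  · ext x
    rw [SetLike.mem_coe, Language.Substructure.mem_sSup_of_directedOn hne hchain.directedOn]
    simp [c]

/-- Representatives for conjugacy over all subsets of `N` of size at most `χ`. -/
theorem IsMonster.exists_uniform_conj_representatives {κ : Cardinal.{u}}
    (hC : K.IsMonster κ C) {χ : Cardinal.{u}} (hχ : K.LS ≤ χ) (hχκ : χ < κ)
    {N : Set C} (hN : #N ≤ 2 ^ χ) {ι : Type u} (a : ι → C) (B : ι → Set C)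
    (hB : ∀ i, #(B i) ≤ χ) :
    ∃ W : Set ι, #W ≤ 2 ^ χ ∧ ∀ s ⊆ N, #s ≤ χ →
      ∀ i, ∃ j ∈ W, ConjOver L s (a i) (B i) (a j) (B j) := by
  have hχ0 : ℵ₀ ≤ χ := aleph0_le_LS.trans hχ
  have h2χ : ℵ₀ ≤ (2 : Cardinal.{u}) ^ χ := hχ0.trans (cantor χ).le
  choose W hW hWc using fun t : {t : Set C // t ⊆ N ∧ #t ≤ χ} =>
    hC.exists_conj_representatives hχ hχκ t.2.2 a B hB
  refine ⟨⋃ t, W t, ?_, ?_⟩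
  · refine (mk_iUnion_le _).trans (mul_le_of_le h2χ ?_ (ciSup_le' hW))
    refine (mk_bounded_subset_le N χ).trans ?_
    -- A set of size `2 ^ χ` has only `2 ^ χ` subsets of size at most `χ`, so the representatives
    -- over all of them can be collected.
    calc max #N ℵ₀ ^ χ ≤ (2 ^ χ) ^ χ := power_le_power_right (max_le hN h2χ)
      _ = 2 ^ χ := by rw [← power_mul, mul_eq_self hχ0]
  · intro s hs hsχ i
    obtain ⟨j, hj, h⟩ := hWc ⟨s, hs, hsχ⟩ i
    exact ⟨j, Set.mem_iUnion.2 ⟨_, hj⟩, h⟩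

/-- A strong submodel of size at most `2 ^ χ` that contains, up to conjugacy over each of its
subsets of size at most `χ`, every `B i`. -/
theorem IsMonster.exists_conj_closed {κ : Cardinal.{u}}
    (hC : K.IsMonster κ C) {χ : Cardinal.{u}} (hχ : K.LS ≤ χ) (hχκ : χ < κ)
    {A : Set C} (hA : #A ≤ χ) {ι : Type u} (a : ι → C) (B : ι → Set C)
    (hB : ∀ i, #(B i) ≤ χ) :
    ∃ (N : L.Substructure C) (W : Set ι), K.strong N ∧ #N ≤ 2 ^ χ ∧ A ⊆ N ∧ #W ≤ 2 ^ χ ∧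
      (∀ i ∈ W, B i ⊆ N) ∧ ∀ s ⊆ (N : Set C), #s ≤ χ →
        ∀ i, ∃ j ∈ W, ConjOver L s (a i) (B i) (a j) (B j) := by
  have hχ0 : ℵ₀ ≤ χ := aleph0_le_LS.trans hχ
  have hχ2 : χ ≤ 2 ^ χ := (cantor χ).le
  have h2χ : ℵ₀ ≤ (2 : Cardinal.{u}) ^ χ := hχ0.trans hχ2
  have hW : ∀ N : Set C, ∃ W : Set ι, #W ≤ 2 ^ χ ∧ (#N ≤ 2 ^ χ → ∀ s ⊆ N, #s ≤ χ →
      ∀ i, ∃ j ∈ W, ConjOver L s (a i) (B i) (a j) (B j)) := by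
    intro N
    by_cases hN : #N ≤ 2 ^ χ
    · obtain ⟨W, h1, h2⟩ := hC.exists_uniform_conj_representatives hχ hχκ hN a B hB
      exact ⟨W, h1, fun _ => h2⟩
    · exact ⟨∅, by simp, fun h => absurd h hN⟩
  choose W hWcard hW using hW
  -- With chain length `χ⁺`, every subset of the union of size at most `χ` already lies in one
  -- stage, while `χ⁺ ≤ 2 ^ χ` keeps the union small.
  have hρ : (Order.succ χ).IsRegular := isRegular_succ hχ0
  have hρ0 : 0 < (Order.succ χ).ord := by simp
  have hρχ : (Order.succ χ) ≤ 2 ^ χ := Order.succ_le_of_lt (cantor χ)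
  obtain ⟨F, hF⟩ := exists_transfinite (X := L.Substructure C) (fun i h x =>
      i < (Order.succ χ).ord → (∀ j, #(h j) ≤ 2 ^ χ) → K.strong x ∧ #x ≤ 2 ^ χ ∧ A ⊆ x ∧
        ∀ j, h j ≤ x ∧ ∀ w ∈ W (h j), B w ⊆ x) (by
    intro i h
    by_cases hi : i < (Order.succ χ).ord
    swap
    · exact ⟨⊤, fun h => absurd h hi⟩
    by_cases hh : ∀ j, #(h j) ≤ 2 ^ χ
    swap
    · exact ⟨⊤, fun _ h => absurd h hh⟩
    obtain ⟨x, hx, hsub, hcard⟩ := exists_strong_superset hC.mem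
      (A ∪ ⋃ j, ((h j : Set C) ∪ ⋃ w ∈ W (h j), B w))
    refine ⟨x, fun _ _ => ⟨hx, ?_, fun y hy => hsub (Or.inl hy), fun j => ⟨?_, ?_⟩⟩⟩
    · refine hcard.trans (add_le_of_le h2χ ?_ (hχ.trans hχ2))
      refine (mk_union_le _ _).trans (add_le_of_le h2χ (hA.trans hχ2) ?_)
      refine mk_iUnion_Iio_le ((lt_ord.1 hi).le.trans hρχ) h2χ _ fun j => ?_
      refine (mk_union_le _ _).trans (add_le_of_le h2χ (hh j) ?_)
      exact mk_biUnion_le_of_forall h2χ _ (hWcard _) B fun i => (hB i).trans hχ2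
    · intro y hy
      exact hsub (Or.inr (Set.mem_iUnion.2 ⟨j, Or.inl hy⟩))
    · intro w hw y hy
      exact hsub (Or.inr (Set.mem_iUnion.2 ⟨j, Or.inr (Set.mem_biUnion hw hy)⟩)))
  have hcard : ∀ i < (Order.succ χ).ord, #(F i) ≤ 2 ^ χ := by
    intro i
    induction i using WellFoundedLT.induction with
    | _ i ih => exact fun hi => (hF i hi fun j => ih j j.2 (j.2.trans hi)).2.1
  have hF' := fun i hi => hF i hi fun j => hcard j (j.2.trans hi)
  have hmono : ∀ i < (Order.succ χ).ord, ∀ j < i, F j ≤ F i :=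
    fun i hi j hj => ((hF' i hi).2.2.2 ⟨j, hj⟩).1
  obtain ⟨U, hU, hUeq⟩ := exists_strong_iUnion hρ0 F (fun i hi => (hF' i hi).1) hmono
  have hFU : ∀ i < (Order.succ χ).ord, (F i : Set C) ⊆ U := by
    intro i hi
    rw [hUeq]
    exact Set.subset_iUnion (fun i : Set.Iio (Order.succ χ).ord => (F i : Set C)) ⟨i, hi⟩
  have hlim := (isSuccLimit_ord hρ.aleph0_le)
  have ho : (Order.succ χ).ord.card ≤ 2 ^ χ := by simpa using hρχ
  have hsucc : ∀ i < (Order.succ χ).ord, Order.succ i < (Order.succ χ).ord :=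
    fun i hi => hlim.succ_lt hi
  refine ⟨U, ⋃ i : Set.Iio (Order.succ χ).ord, W (F i), hU, ?_, ?_, ?_, ?_, ?_⟩
  · have : #(U : Set C) ≤ 2 ^ χ := by
      rw [hUeq]
      exact mk_iUnion_Iio_le ho h2χ _ fun j => hcard j j.2
    exact this
  · exact (hF' 0 hρ0).2.2.1.trans (hFU 0 hρ0)
  · exact mk_iUnion_Iio_le ho h2χ _ fun j => hWcard _
  · intro w hw
    obtain ⟨i, hi⟩ := Set.mem_iUnion.1 hw
    -- The representatives belonging to stage `i` are absorbed only at stage `i + 1`.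
    exact (((hF' _ (hsucc i i.2)).2.2.2 ⟨i, Order.lt_succ i.1⟩).2 w hi).trans
      (hFU _ (hsucc i i.2))
  · intro s hs hsχ i
    rw [hUeq] at hs
    obtain ⟨j, hj, hsj⟩ := exists_subset_of_subset_iUnion hρ (fun i => (F i : Set C)) hmono
      (Order.lt_succ_of_le hsχ) hs
    obtain ⟨w, hw, h⟩ := hW (F j) (hcard j hj) s hsj hsχ i
    exact ⟨w, Set.mem_iUnion.2 ⟨⟨j, hj⟩, hw⟩, h⟩

/-- Among more than `2 ^ χ` sets there are two which are conjugate and independent over a model of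
size at most `χ`. -/
theorem IsIndependence.exists_conj_independent {κ : Cardinal.{u}}
    {Ind : L.Substructure C → Set C → Set C → Prop} (hInd : K.IsIndependence κ Ind)
    (hC : K.IsMonster κ C) {χ : Cardinal.{u}} (hχ : K.LS ≤ χ) (hχκ : 2 ^ χ < κ)
    (hloc : ∀ M : L.Substructure C, K.strong M → #M < κ → ∀ D : Set C, D.Nonempty →
      #D ≤ K.LS → ∃ M₀ : L.Substructure C, K.strong M₀ ∧ M₀ ≤ M ∧ #M₀ ≤ χ ∧ Ind M₀ D M)
    {A : Set C} (hA : #A ≤ χ) {ι : Type u} (hι : 2 ^ χ < #ι) (a : ι → C) (B : ι → Set C)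
    (hB : ∀ i, #(B i) ≤ K.LS) :
    ∃ (N : L.Substructure C) (i j : ι), K.strong N ∧ A ⊆ N ∧ #N ≤ χ ∧ i ≠ j ∧
      ConjOver L N (a i) (B i) (a j) (B j) ∧ Ind N (B i) (B j) := by
  have hχ0 : ℵ₀ ≤ χ := aleph0_le_LS.trans hχ
  have hχκ' : χ < κ := (cantor χ).trans hχκ
  obtain ⟨U, W, hU, hUcard, hAU, hWcard, hWU, hW⟩ :=
    hC.exists_conj_closed hχ hχκ' hA a B fun i => (hB i).trans hχ
  obtain ⟨i, hi⟩ : ∃ i, i ∉ W := by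
    by_contra! h
    have hWu : W = Set.univ := Set.eq_univ_of_forall h
    rw [hWu, mk_univ] at hWcard
    exact absurd hι hWcard.not_gt
  have hUκ : #U < κ := hUcard.trans_lt hχκ
  -- `B i` may be empty, whereas types are of nonempty sequences; adding `a i` avoids this.
  have hD : #(insert (a i) (B i) : Set C) ≤ K.LS :=
    mk_insert_le.trans (add_le_of_le aleph0_le_LS (hB i) (one_le_aleph0.trans aleph0_le_LS))
  obtain ⟨M₀, hM₀, hM₀U, hM₀card, hM₀ind⟩ := hloc U hU hUκ _ (Set.insert_nonempty _ _) hD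
  obtain ⟨N, hN, hNU, hsub, hNcard⟩ := exists_strong_between U hU (A ∪ M₀)
    (Set.union_subset hAU hM₀U)
  have hNχ : #N ≤ χ := hNcard.trans
    (add_le_of_le hχ0 ((mk_union_le _ _).trans (add_le_of_le hχ0 hA hM₀card)) hχ)
  obtain ⟨j, hj, hconj⟩ := hW N hNU hNχ i
  have hDκ := (hD.trans hχ).trans_lt hχκ'
  have hNκ := hNχ.trans_lt hχκ'
  refine ⟨N, i, j, hN, fun x hx => hsub (Or.inl hx), hNχ, fun h => hi (h ▸ hj), hconj, ?_⟩
  have h1 := hInd.baseMonotonicity M₀ N _ _ hM₀ hN (hM₀card.trans_lt hχκ') hNκ hDκ hUκ hM₀ind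
    (fun x hx => hsub (Or.inr hx)) hNU
  exact hInd.monotonicity N _ _ _ _ hN hNκ hDκ hUκ h1 (Set.subset_insert _ _) (hWU j hj)

end AEC

/-! ### Amalgamating conjugate types and building the branch -/

namespace AEC

variable {L : FirstOrder.Language.{u, u}} {K : AEC L} {C : Type u} [L.Structure C]

/-- Keeps all the exponentials formed below `κ` small. -/
theorem isStrongLimit_of_beth_ord_eq {κ : Cardinal.{u}} (hκ : ℶ_ κ.ord = κ) (h0 : ℵ₀ ≤ κ) :
    κ.IsStrongLimit := by
  rw [← hκ]
  exact isStrongLimit_beth.2 (isSuccLimit_ord h0).isSuccPrelimit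

theorem snoc_res {X : Type*} {μ : Ordinal.{u}} (ν : Set.Iio μ → X) (α : Set.Iio μ)
    (h : Order.succ α.1 < μ) : snoc (res ν α) (ν α) = res ν ⟨Order.succ α.1, h⟩ := by
  funext i
  unfold snoc res
  split_ifs with hi
  · rfl
  · have : i.1 = α.1 := le_antisymm (Order.lt_succ_iff.1 i.2) (not_lt.1 hi)
    congr 1
    exact Subtype.ext this.symm

theorem TpEq.reindex {I J : Type*} {A : Set C} {b₁ b₂ : I → C} (h : K.TpEq A b₁ b₂)
    (g : J → I) : K.TpEq A (fun j => b₁ (g j)) (fun j => b₂ (g j)) := by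
  obtain ⟨N, _, f₁, f₂, h1, h2, h3, h4, h5⟩ := h
  exact ⟨N, _, f₁, f₂, h1, h2, h3, h4, fun i => h5 (g i)⟩

theorem range_const_punit (c : C) : Set.range (fun _ : PUnit.{u + 1} => c) = {c} :=
  Set.range_const

/-- If `B` and its conjugate `f[B]` over `M` are independent over `M` and `tp(c/B)` does not fork
over `M`, then `tp(c/B)` and its conjugate `tp(f(c)/f[B])` are simultaneously realized. -/
theorem IsSimpleIndependence.exists_realize_conj {κ : Cardinal.{u}} (hC : K.IsMonster κ C)
    (hLS : K.LS < κ) {Ind : L.Substructure C → Set C → Set C → Prop}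
    (hInd : K.IsSimpleIndependence κ Ind)
    {M : L.Substructure C} (hM : K.strong M) (hMκ : #M < κ) {B : Set C} (hB : #B < κ)
    (f : C ≃[L] C) (hf : ∀ x ∈ M, f x = x) (hBB : Ind M B (f '' B)) {c : C}
    (hc : Ind M {c} B) :
    ∃ b : C, K.TpEq B (fun _ : Unit => b) (fun _ => c) ∧
      K.TpEq (f '' B) (fun _ : Unit => b) (fun _ => f c) := by
  have hκ0 : ℵ₀ ≤ κ := aleph0_le_LS.trans hLS.le
  have hBf : #(f '' B : Set C) < κ := mk_image_le.trans_lt hB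
  have hsing : ∀ x : C, #({x} : Set C) < κ := fun x => by
    rw [mk_singleton]
    exact one_lt_aleph0.trans_le hκ0
  have hMset : #(M : Set C) < κ := hMκ
  have hun : ∀ s : Set C, #s < κ → #(s ∪ M : Set C) < κ := fun s hs =>
    (mk_union_le _ _).trans_lt (add_lt_of_lt hκ0 hs hMset)
  have hMf : M.map f.toHom = M := by
    apply SetLike.coe_injective
    ext x
    simp only [Language.Substructure.coe_map, Set.mem_image, SetLike.mem_coe]
    constructor
    · rintro ⟨y, hy, rfl⟩
      have := hf y hy
      simpa [this] using hy
    · intro hx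
      exact ⟨x, hx, hf x hx⟩
  have hfc : Ind M {f c} (f '' B) := by
    have := (hInd.preservation M {c} B f hM hMκ (hsing c) hB).1 hc
    rwa [hMf, Set.image_singleton] at this
  -- Normality adds `M` on both sides; monotonicity then removes it on the left.
  have hext : ∀ (x : C) (D : Set C), #D < κ → Ind M {x} D → Ind M {x} (D ∪ M) := by
    intro x D hD h
    exact hInd.monotonicity M _ _ _ _ hM hMκ (hun _ (hsing x)) (hun _ hD)
      ((hInd.normality M _ _ hM hMκ (hsing x) hD).1 h) Set.subset_union_left subset_rfl
  obtain ⟨N, hN, hsub, hcard⟩ := exists_strong_superset hC.mem ((B ∪ M) ∪ (f '' B ∪ M))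
  have hNκ : #N < κ := hcard.trans_lt (add_lt_of_lt hκ0
    ((mk_union_le _ _).trans_lt (add_lt_of_lt hκ0 (hun _ hB) (hun _ hBf))) hLS)
  obtain ⟨b, hb1, hb2, -⟩ := hInd.typeAmalgamation M N (B ∪ M) (f '' B ∪ M) hM hN hMκ hNκ
    Set.subset_union_right Set.subset_union_right (Set.subset_union_left.trans hsub)
    (Set.subset_union_right.trans hsub) ((hInd.normality M _ _ hM hMκ hB hBf).1 hBB)
    PUnit.{u + 1} (by rw [mk_punit]; exact one_lt_aleph0.trans_le hκ0)
    (fun _ => c) (fun _ => f c) (tpEq_of_aut hC.mem f hf _)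
    (by rw [range_const_punit]; exact hext c B hB hc)
    (by rw [range_const_punit]; exact hext (f c) _ hBf hfc)
  exact ⟨b PUnit.unit, (hb1.mono Set.subset_union_left).reindex fun _ => PUnit.unit,
    (hb2.mono Set.subset_union_left).reindex fun _ => PUnit.unit⟩

/-- A branch of the tree together with an increasing chain of models such that at each node the
chosen child is conjugate to, and independent from, another child. -/
theorem IsIndependence.exists_independent_branch {κ : Cardinal.{u}}
    {Ind : L.Substructure C → Set C → Set C → Prop} (hInd : K.IsIndependence κ Ind)
    (hC : K.IsMonster κ C) {χ μ lam : Cardinal.{u}} (hχ : K.LS ≤ χ) (hχκ : 2 ^ χ < κ)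
    (hμ : ℵ₀ ≤ μ) (hμχ : μ ≤ χ) (hlam : 2 ^ χ < lam)
    (hloc : ∀ M : L.Substructure C, K.strong M → #M < κ → ∀ D : Set C, D.Nonempty →
      #D ≤ K.LS → ∃ M₀ : L.Substructure C, K.strong M₀ ∧ M₀ ≤ M ∧ #M₀ ≤ χ ∧ Ind M₀ D M)
    (a : ∀ α : Ordinal.{u}, (Set.Iio α → Set.Iio lam.ord) → C)
    (B : ∀ α : Ordinal.{u}, (Set.Iio α → Set.Iio lam.ord) → Set C)
    (hB : ∀ α < μ.ord, ∀ η : Set.Iio α → Set.Iio lam.ord, #(B α η) ≤ K.LS) :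
    ∃ (N : Ordinal.{u} → L.Substructure C) (ν ν' : Set.Iio μ.ord → Set.Iio lam.ord),
      ∀ α : Set.Iio μ.ord, K.strong (N α) ∧ #(N α) ≤ χ ∧ (∀ j < α.1, N j ≤ N α) ∧
        B (Order.succ α.1) (snoc (res ν α) (ν α)) ⊆ N (Order.succ α.1) ∧ ν α ≠ ν' α ∧
        ConjOver L (N α) (a _ (snoc (res ν α) (ν α))) (B _ (snoc (res ν α) (ν α)))
          (a _ (snoc (res ν α) (ν' α))) (B _ (snoc (res ν α) (ν' α))) ∧
        Ind (N α) (B _ (snoc (res ν α) (ν α))) (B _ (snoc (res ν α) (ν' α))) := by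
  have hχ0 : ℵ₀ ≤ χ := aleph0_le_LS.trans hχ
  have hsucc : ∀ i < μ.ord, Order.succ i < μ.ord := fun i hi => (isSuccLimit_ord hμ).succ_lt hi
  have hz : (0 : Ordinal.{u}) < lam.ord := by
    rw [Cardinal.ord_pos]
    exact zero_le.trans_lt hlam
  let z : Set.Iio lam.ord := ⟨0, hz⟩
  let X := L.Substructure C × Set.Iio lam.ord × Set.Iio lam.ord
  let seq : ∀ i : Ordinal.{u}, (Set.Iio i → X) → Set.Iio i → Set.Iio lam.ord :=
    fun _ h j => (h j).2.1
  obtain ⟨F, hF⟩ := exists_transfinite (X := X) (fun i h x =>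
      i < μ.ord → (∀ j, #(h j).1 ≤ χ) → K.strong x.1 ∧ #x.1 ≤ χ ∧
        (∀ j, (h j).1 ≤ x.1 ∧ B (Order.succ j.1)
          (snoc (seq j.1 fun k => h ⟨k.1, lt_trans (Set.mem_Iio.1 k.2) (Set.mem_Iio.1 j.2)⟩) (h j).2.1) ⊆ x.1) ∧
        x.2.1 ≠ x.2.2 ∧
        ConjOver L x.1 (a _ (snoc (seq i h) x.2.1)) (B _ (snoc (seq i h) x.2.1))
          (a _ (snoc (seq i h) x.2.2)) (B _ (snoc (seq i h) x.2.2)) ∧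
        Ind x.1 (B _ (snoc (seq i h) x.2.1)) (B _ (snoc (seq i h) x.2.2))) (by
    intro i h
    by_cases hi : i < μ.ord
    swap
    · exact ⟨⟨⊤, z, z⟩, fun h => absurd h hi⟩
    by_cases hh : ∀ j, #(h j).1 ≤ χ
    swap
    · exact ⟨⟨⊤, z, z⟩, fun _ h => absurd h hh⟩
    have hA : #(⋃ j : Set.Iio i, (((h j).1 : Set C) ∪ B (Order.succ j.1)
          (snoc (seq j.1 fun k => h ⟨k.1, lt_trans (Set.mem_Iio.1 k.2) (Set.mem_Iio.1 j.2)⟩) (h j).2.1)) : Set C) ≤ χ := by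
      refine mk_iUnion_Iio_le ((lt_ord.1 hi).le.trans hμχ) hχ0 _ fun j => ?_
      exact (mk_union_le _ _).trans (add_le_of_le hχ0 (hh j)
        ((hB _ (hsucc _ (lt_trans j.2 hi)) _).trans hχ))
    obtain ⟨N, β, β', hN, hAN, hNχ, hne, hconj, hind⟩ :=
      -- The set to be covered consists of all earlier models and the `B` of all children chosen so
      -- far.
      hInd.exists_conj_independent hC hχ hχκ hloc hA (ι := lam.ord.ToType)
        (by rwa [mk_toType, card_ord]) (fun β => a _ (snoc (seq i h) β.toOrd))
        (fun β => B _ (snoc (seq i h) β.toOrd)) (fun β => hB _ (hsucc i hi) _)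
    refine ⟨⟨N, β.toOrd, β'.toOrd⟩, fun _ _ => ⟨hN, hNχ, fun j => ⟨?_, ?_⟩, ?_, hconj, hind⟩⟩
    · intro x hx
      exact hAN (Set.mem_iUnion.2 ⟨j, Or.inl hx⟩)
    · intro x hx
      exact hAN (Set.mem_iUnion.2 ⟨j, Or.inr hx⟩)
    · exact fun h => hne (Ordinal.ToType.mk.symm.injective h))
  have hcard : ∀ i < μ.ord, #(F i).1 ≤ χ := by
    intro i
    induction i using WellFoundedLT.induction with
    | _ i ih => exact fun hi => (hF i hi fun j => ih j j.2 (lt_trans j.2 hi)).2.1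
  have hF' := fun i hi => hF i hi fun j => hcard j (lt_trans j.2 hi)
  refine ⟨fun i => (F i).1, fun i => (F i).2.1, fun i => (F i).2.2, fun α => ?_⟩
  obtain ⟨h1, h2, h3, h4, h5, h6⟩ := hF' α α.2
  refine ⟨h1, h2, fun j hj => (h3 ⟨j, hj⟩).1, ?_, h4, h5, h6⟩
  exact ((hF' _ (hsucc α α.2)).2.2.1 ⟨α, Order.lt_succ α.1⟩).2

end AEC

/-! ### The contradiction -/

open AEC in
theorem mainTheorem1 {L : FirstOrder.Language.{u, u}} (K : AEC L)
    (hJEP : K.JointEmbedding) (hAP : K.Amalgamation) (hNMM : K.NoMaximalModels)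
    (κ : Cardinal.{u}) (hκ : ℶ_ κ.ord = κ) (hLS : K.LS < κ)
    (C : Type u) [L.Structure C] (hC : K.IsMonster κ C)
    (Ind : L.Substructure C → Set C → Set C → Prop)
    (hInd : K.IsSimpleIndependence κ Ind) :
    ¬ K.TreeProperty κ C 2 := by
  intro hTP
  have hLS0 : ℵ₀ ≤ K.LS := aleph0_le_LS
  have hκ0 : ℵ₀ ≤ κ := hLS0.trans hLS.le
  have hlim := isStrongLimit_of_beth_ord_eq hκ hκ0
  obtain ⟨lam₀, θ, hlam₀, hθ, hlc⟩ := hInd.uniformLocalCharacter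
  set μ : Cardinal.{u} := Order.succ (K.LS + lam₀)
  have hsum0 : ℵ₀ ≤ K.LS + lam₀ := hLS0.trans (self_le_add_right _ _)
  have hμreg : μ.IsRegular := isRegular_succ hsum0
  have hpow : ∀ x : Cardinal.{u}, x < κ → 2 ^ x < κ := fun x hx => hlim.isStrongPrelimit hx
  have hsuccκ : ∀ x : Cardinal.{u}, x < κ → Order.succ x < κ := fun x hx =>
    (Order.succ_le_of_lt (cantor x)).trans_lt (hpow x hx)
  have hμκ : μ < κ := hsuccκ _ (add_lt_of_lt hκ0 hLS hlam₀)
  have hLSμ : K.LS ≤ μ := (self_le_add_right _ _).trans (Order.le_succ _)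
  -- `lam₀ + LS ^ θ` bounds the bases of types of length at most `LS`; `μ` is added so that unions
  -- of fewer than or exactly `μ` models stay of size `χ`.
  set χ : Cardinal.{u} := μ + (lam₀ + K.LS ^ θ)
  have hμχ : μ ≤ χ := self_le_add_right _ _
  have hLSχ : K.LS ≤ χ := hLSμ.trans hμχ
  have hχκ : χ < κ := by
    refine add_lt_of_lt hκ0 hμκ (add_lt_of_lt hκ0 hlam₀ ?_)
    calc K.LS ^ θ ≤ (2 ^ K.LS) ^ θ := power_le_power_right (cantor _).le
      _ = 2 ^ (K.LS * θ) := by rw [power_mul]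
      _ < κ := hpow _ (mul_lt_of_lt hκ0 hLS hθ)
  set lam : Cardinal.{u} := Order.succ (2 ^ χ)
  have hlamκ : lam < κ := hsuccκ _ (hpow _ hχκ)
  have hlamχ : 2 ^ χ < lam := Order.lt_succ _
  have hLSlam : K.LS ≤ lam := hLSχ.trans ((cantor χ).trans hlamχ).le
  have hloc : ∀ M : L.Substructure C, K.strong M → #M < κ → ∀ D : Set C, D.Nonempty →
      #D ≤ K.LS → ∃ M₀ : L.Substructure C, K.strong M₀ ∧ M₀ ≤ M ∧ #M₀ ≤ χ ∧ Ind M₀ D M := by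
    intro M hM hMκ D hD hDcard
    have := hD.to_subtype
    obtain ⟨M₀, h1, h2, h3, h4⟩ := hlc M hM hMκ D (hDcard.trans_lt hLS) (fun x => x.1)
    rw [Subtype.range_coe] at h4
    refine ⟨M₀, h1, h2, h3.trans ?_, h4⟩
    refine le_trans (add_le_add_right ?_ _) (self_le_add_left _ _)
    refine powerlt_le.2 fun x hx => (power_le_power_right hDcard).trans ?_
    exact power_le_power_left (aleph0_pos.trans_le hLS0).ne' hx.le
  obtain ⟨a, B, hB, hcons, hcontra⟩ := hTP μ lam hLSμ hμκ hLSlam hlamκ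
  obtain ⟨N, ν, ν', hN⟩ := hInd.exists_independent_branch hC hLSχ (hpow _ hχκ) hμreg.aleph0_le
    hμχ hlamχ hloc a B fun α hα η => (hB α hα η).le
  obtain ⟨c, hc⟩ := hcons ν
  have hmono : ∀ i < μ.ord, ∀ j < i, N j ≤ N i := fun i hi => (hN ⟨i, hi⟩).2.2.1
  have hμ0 : 0 < μ.ord := by rw [Cardinal.ord_pos]; exact hμreg.pos
  obtain ⟨U, hU, hUeq⟩ := exists_strong_iUnion hμ0 N (fun i hi => (hN ⟨i, hi⟩).1) hmono
  have hNU : ∀ i < μ.ord, (N i : Set C) ⊆ U := by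
    intro i hi
    rw [hUeq]
    exact Set.subset_iUnion (fun i : Set.Iio μ.ord => (N i : Set C)) ⟨i, hi⟩
  have hUκ : #U < κ := by
    have : #(U : Set C) ≤ χ := by
      rw [hUeq]
      exact mk_iUnion_Iio_le (by simpa using hμχ) (hLS0.trans hLSχ) _ fun j => (hN j).2.1
    exact lt_of_le_of_lt this hχκ
  have h1κ : #PUnit.{u + 1} < κ := by rw [mk_punit]; exact one_lt_aleph0.trans_le hκ0
  obtain ⟨M₀, hM₀, hM₀U, hM₀card, hM₀ind⟩ := hlc U hU hUκ PUnit.{u + 1} h1κ fun _ => c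
  rw [range_const_punit] at hM₀ind
  -- A single element has length `1`, and `1 ^< θ ≤ 1`, so its base has size at most `LS + lam₀`,
  -- strictly below `μ`.
  have hM₀μ : #M₀ < μ := by
    refine lt_of_le_of_lt (hM₀card.trans ?_) (Order.lt_succ _)
    rw [add_comm]
    refine add_le_add_left (powerlt_le.2 fun x _ => ?_) _
    rw [mk_punit, one_power]
    exact one_le_aleph0.trans hLS0
  obtain ⟨i, hi, hM₀i⟩ := exists_subset_of_subset_iUnion hμreg (fun i => (N i : Set C)) hmono
    hM₀μ (hUeq ▸ hM₀U)
  have hsi : Order.succ i < μ.ord := (isSuccLimit_ord hμreg.aleph0_le).succ_lt hi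
  obtain ⟨hNi, hNicard, -, hBN, hne, ⟨f, hfN, hfa, hfB⟩, hindB⟩ := hN ⟨i, hi⟩
  have hNiκ := hNicard.trans_lt hχκ
  have hcκ : #({c} : Set C) < κ := by rw [mk_singleton]; exact one_lt_aleph0.trans_le hκ0
  set η := snoc (res ν ⟨i, hi⟩) (ν ⟨i, hi⟩) with hη
  set η' := snoc (res ν ⟨i, hi⟩) (ν' ⟨i, hi⟩)
  -- The base is enlarged from `M₀` to `N i`, and `U` shrunk to the chosen child's `B`, which lies
  -- in the model of stage `i + 1`.
  have hcN : Ind (N i) {c} (B _ η) :=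
    hInd.monotonicity _ _ _ _ _ hNi hNiκ hcκ hUκ
      (hInd.baseMonotonicity M₀ (N i) _ _ hM₀ hNi (hM₀μ.trans hμκ) hNiκ hcκ hUκ hM₀ind hM₀i
        (hNU i hi)) subset_rfl (hBN.trans (hNU _ hsi))
  have hctp : K.TpEq (B _ η) (fun _ : Unit => c) (fun _ => a _ η) := by
    rw [hη, snoc_res ν ⟨i, hi⟩ hsi]
    exact hc ⟨Order.succ i, hsi⟩ trivial
  obtain ⟨b, hb1, hb2⟩ := hInd.exists_realize_conj hC hLS hNi hNiκ ((hB _ hsi η).trans hLS) f hfN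
    (by rw [hfB]; exact hindB) hcN
  have hctp' := hctp.map hC.mem f
  rw [hfB] at hb2 hctp'
  rw [hfa] at hctp'
  classical
  -- `b` realizes the types at the two distinct children `ν i` and `ν' i`.
  refine hcontra i hi (res ν ⟨i, hi⟩) {ν ⟨i, hi⟩, ν' ⟨i, hi⟩} (Finset.card_pair hne) ⟨b, ?_⟩
  intro β hβ
  simp only [Finset.coe_insert, Finset.coe_singleton, Set.mem_insert_iff,
    Set.mem_singleton_iff] at hβ
  rcases hβ with rfl | rfl
  · exact hb1.trans hAP hctp
  · exact hb2.trans hAP hctp'
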